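/- All graphs are finite, simple and undirected, and a connected graph has at least one vertex. For a graph $G$ with vertex set $V$ and indeterminates $X_G=\{x_u : u\in V\}$, the generalized Laplacian $L(G,X_G)$ is the $V\times V$ matrix over $\mathbb{R}[X_G]$ with diagonal entries $L(G,X_G)_{uu}=x_u$ and, for $u\neq v$, $L(G,X_G)_{uv}=-1$ if $u$ and $v$ are adjacent and $0$ otherwise. For $1\le i\le |V|$, let $I_i^{\mathbb{R}}(G,X_G)\subseteq\mathbb{R}[X_G]$ be the ideal generated by the determinants of all $i\times i$ submatrices of $L(G,X_G)$. The real algebraic co-rank $\gamma_{\mathbb{R}}(G)$ is the largest $i$ with $1\le i\le|V|$ such that $I_i^{\mathbb{R}}(G,X_G)=\mathbb{R}[X_G]$, and $\gamma_{\mathbb{R}}(G)=0$ if there is no such $i$. Write $K_n$, $P_n$, $C_n$ for the complete graph, the path and the cycle on $n$ vertices, $K_{n_1,\dots,n_k}$ for the complete multipartite graph with parts of sizes $n_1,\dots,n_k$, $\overline{H}$ for the complement of $H$, $G+H$ (also $G\cup H$) for the disjoint union, and $G\vee H$ for the join, i.e. the disjoint union together with all edges between $G$ and $H$. Let $\ltimes$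 be the graph on $5$ vertices obtained from a triangle by attaching two pendant vertices to the same vertex of the triangle; let $\mathsf{dart}$ be the graph on $5$ vertices obtained from $K_4$ minus an edge by attaching a pendant vertex to one of the two vertices of degree $3$; and let $K_5\setminus P_3$ be $K_5$ with the two edges of a path on three vertices deleted. For a family $\mathfrak{F}$ of graphs, $G$ is $\mathfrak{F}$-free if no induced subgraph of $G$ is isomorphic to a member of $\mathfrak{F}$. **Theorem.** Let $G$ be a connected graph. Then the following are equivalent. 1. $\gamma_{\mathbb{R}}(G)\le 2$. 2. $G$ is $\{P_4,\ \ltimes,\ \mathsf{dart},\ K_5\setminus P_3,\ \overline{P_2\cup C_4},\ K_{2,2,2},\ K_{2,2,1,1}\}$-free. 3. $G$ is isomorphic to an induced subgraph of one of the graphs $K_{1,n_1,n_2}$, $\overline{K_1}\vee(K_{n_2}+K_{n_3})$ or $\overline{K_{n_1}}\vee(K_1+K_{n_3})$, for some positive integers $n_1,n_2,n_3$. -/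

import Mathlib

namespace CriticalIdeal

noncomputable section

/-- The generalized Laplacian matrix `L(G, X_G)` of a simple graph `G` over `R[X_G]`: the diagonal
entry at `u` is the variable `x_u`, and the off-diagonal entry at `(u, v)` is minus the number
(`0` or `1`) of edges between `u` and `v`. -/
def genLaplacian (R : Type*) [CommRing R] {V : Type*} [DecidableEq V]
    (G : SimpleGraph V) [DecidableRel G.Adj] : Matrix V V (MvPolynomial V R) :=
  Matrix.of fun u v =>
    if u = v then MvPolynomial.X u else if G.Adj u v then -1 else 0

/-- The `i`-th critical ideal of `G`: the ideal of `R[X_G]` generated by the determinants of the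
`i × i` submatrices of the generalized Laplacian. Row and column sets are listed by injections
from `Fin i`; reordering the rows or columns only changes the sign of a minor. -/
def criticalIdeal (R : Type*) [CommRing R] {V : Type*} [DecidableEq V]
    (G : SimpleGraph V) [DecidableRel G.Adj] (i : ℕ) : Ideal (MvPolynomial V R) :=
  Ideal.span (Set.range fun p : (Fin i ↪ V) × (Fin i ↪ V) =>
    ((genLaplacian R G).submatrix p.1 p.2).det)

/-- The algebraic co-rank `γ_R(G)`: the largest `i` (at most the number of vertices) for which the
`i`-th critical ideal is the whole ring. The index `i = 0` always qualifies (the empty minor is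
`1`), so the co-rank is `0` when no ideal of positive index is trivial. -/
def algebraicCorank (R : Type*) [CommRing R] {V : Type*} [Fintype V] [DecidableEq V]
    (G : SimpleGraph V) [DecidableRel G.Adj] : ℕ :=
  sSup {i : ℕ | i ≤ Fintype.card V ∧ criticalIdeal R G i = ⊤}

end

/-- The join `G ∨ H` of two graphs: the disjoint union together with all edges between them. -/
def join {V W : Type*} (G : SimpleGraph V) (H : SimpleGraph W) : SimpleGraph (V ⊕ W) :=
  (G ⊕g H) ⊔ completeBipartiteGraph V W

/-- The graph `⋉`: a triangle `0, 1, 2` with two pendant vertices `3, 4` attached to `2`. -/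
def ltimesGraph : SimpleGraph (Fin 5) :=
  SimpleGraph.fromEdgeSet {s(0, 1), s(0, 2), s(1, 2), s(2, 3), s(2, 4)}

/-- The dart: the triangles `0, 1, 2` and `1, 2, 3` sharing the edge `1, 2`, and a pendant
vertex `4` attached to `2`. -/
def dartGraph : SimpleGraph (Fin 5) :=
  SimpleGraph.fromEdgeSet {s(0, 1), s(0, 2), s(1, 2), s(1, 3), s(2, 3), s(2, 4)}

/-- The graph `K₅ ∖ P₃`: the complete graph on five vertices with the two edges of a path on the
three vertices `0, 1, 2` deleted. -/
def kFiveMinusPThree : SimpleGraph (Fin 5) :=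
  (⊤ : SimpleGraph (Fin 5)).deleteEdges {s(0, 1), s(1, 2)}

/-- The complement of the disjoint union of the path `P₂` on two vertices and the cycle `C₄`. -/
def complPTwoUnionCFour : SimpleGraph (Fin 2 ⊕ Fin 4) :=
  (SimpleGraph.pathGraph 2 ⊕g SimpleGraph.cycleGraph 4)ᶜ

/-- The complete multipartite graph with parts of sizes `n 0, …, n (k - 1)`. -/
def completeMultipartite {k : ℕ} (n : Fin k → ℕ) : SimpleGraph (Σ i : Fin k, Fin (n i)) :=
  SimpleGraph.completeMultipartiteGraph fun i => Fin (n i)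

/-- The graph `K̄_a ∨ (K_b + K_c)`, where `+` is the disjoint union. -/
def coCompleteJoin (a b c : ℕ) : SimpleGraph (Fin a ⊕ (Fin b ⊕ Fin c)) :=
  join (⊤ : SimpleGraph (Fin a))ᶜ ((⊤ : SimpleGraph (Fin b)) ⊕g (⊤ : SimpleGraph (Fin c)))

/-- `G` is `H`-free: no induced subgraph of `G` is isomorphic to `H`. -/
def IndFree {V W : Type*} (H : SimpleGraph W) (G : SimpleGraph V) : Prop :=
  ¬ H.IsIndContained G

end CriticalIdeal

namespace CriticalIdeal

/-! ### Bounds on the co-rank: induced subgraphs from below, singular blow-ups from above. -/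

section Corank

variable {V W R : Type*} [CommRing R] [DecidableEq V] [DecidableEq W]

/-! From 1 to 2: triviality of a critical ideal passes from an induced subgraph to the whole graph,
and each forbidden graph has a `3 × 3` minor that is a nonzero real constant.

From 3 to 1: each listed family partitions its vertices into three classes that determine adjacency.
A suitable real value of the variables on each class turns the Laplacian into a blow-up of a
singular `3 × 3` matrix. All larger minors then vanish as well, so no ideal of index at least `3`
contains `1` (`criticalIdeal_ne_top_of_blowup`).

From 2 to 3: if nonadjacency is transitive, the graph is complete multipartite, and excluding
`K_{2,2,2}` and `K_{2,2,1,1}` limits its parts (`exists_classes_of_transitive`). Otherwise some edge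
`b c` has both ends nonadjacent to a vertex `a`. The common neighbors of `a` and `b` form the
independent class, and the other vertices split into a clique around `a` and a clique around `b`
(`exists_isCoCompleteJoin_of_not_transitive`). -/

theorem genLaplacian_map {G : SimpleGraph V} [DecidableRel G.Adj] {H : SimpleGraph W}
    [DecidableRel H.Adj] (φ : H ↪g G) (a b : W) :
    genLaplacian R G (φ a) (φ b) = MvPolynomial.rename φ (genLaplacian R H a b) := by
  by_cases hab : a = b
  · simp [genLaplacian, hab]
  · by_cases h : H.Adj a b <;> simp [genLaplacian, hab, h]

/-- Renaming the variables along the embedding sends minors to minors, hence `1` to `1`. -/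
theorem criticalIdeal_eq_top_of_embedding {G : SimpleGraph V} [DecidableRel G.Adj]
    {H : SimpleGraph W} [DecidableRel H.Adj] (φ : H ↪g G) {i : ℕ}
    (h : criticalIdeal R H i = ⊤) : criticalIdeal R G i = ⊤ := by
  have hle : (criticalIdeal R H i).map (MvPolynomial.rename φ : _ →ₐ[R] MvPolynomial V R) ≤
      criticalIdeal R G i := by
    rw [criticalIdeal, Ideal.map_span, Ideal.span_le]
    rintro _ ⟨_, ⟨⟨p, q⟩, rfl⟩, rfl⟩
    refine Ideal.subset_span ⟨(p.trans φ.toEmbedding, q.trans φ.toEmbedding), ?_⟩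
    simp only [AlgHom.map_det]
    congr 1
    ext1 a b
    exact genLaplacian_map φ (p a) (q b)
  rw [h, Ideal.map_top] at hle
  exact top_le_iff.1 hle

theorem criticalIdeal_eq_top_of_minor {H : SimpleGraph W} [DecidableRel H.Adj] {i : ℕ}
    (p q : Fin i → W) (hp : p.Injective) (hq : q.Injective)
    (h : IsUnit ((genLaplacian R H).submatrix p q).det) : criticalIdeal R H i = ⊤ :=
  Ideal.eq_top_of_isUnit_mem _ (Ideal.subset_span ⟨(⟨p, hp⟩, ⟨q, hq⟩), rfl⟩) h

theorem indFree_of_algebraicCorank_le [Fintype V] [Fintype W] {G : SimpleGraph V}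
    [DecidableRel G.Adj] {H : SimpleGraph W} [DecidableRel H.Adj] {i : ℕ}
    (hG : algebraicCorank R G ≤ i) (hi : i + 1 ≤ Fintype.card W)
    (h : criticalIdeal R H (i + 1) = ⊤) : IndFree H G := by
  rintro ⟨φ⟩
  have : i + 1 ≤ algebraicCorank R G :=
    le_csSup ⟨Fintype.card V, fun _ hj => hj.1⟩
      ⟨hi.trans (Fintype.card_le_of_embedding φ.toEmbedding),
        criticalIdeal_eq_top_of_embedding φ h⟩
  omega

/-- If the generalized Laplacian of `G` specializes to a blow-up of a singular matrix of size `k`,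
then no critical ideal of index at least `k` is trivial. -/
theorem criticalIdeal_ne_top_of_blowup [Nontrivial R] [Fintype V] {G : SimpleGraph V}
    [DecidableRel G.Adj] {k : ℕ} (M : Matrix (Fin k) (Fin k) R) (hM : M.det = 0) (f : V → Fin k)
    (hf : ∀ u v, u ≠ v → M (f u) (f v) = if G.Adj u v then -1 else 0) :
    ∀ i, k ≤ i → criticalIdeal R G i ≠ ⊤ := by
  intro i hi htop
  -- At this point the Laplacian becomes `M.submatrix f f`, so it suffices that all its minors of
  -- size at least `k` vanish.
  let ev : MvPolynomial V R →+* R := MvPolynomial.eval fun v => M (f v) (f v)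
  have hle : criticalIdeal R G i ≤ RingHom.ker ev := by
    rw [criticalIdeal, Ideal.span_le]
    rintro _ ⟨⟨p, q⟩, rfl⟩
    have hdet : ev ((genLaplacian R G).submatrix p q).det = (M.submatrix (f ∘ p) (f ∘ q)).det := by
      rw [RingHom.map_det]
      congr 1
      ext1 a b
      by_cases hab : p a = q b
      · simp [genLaplacian, hab, ev]
      · by_cases h : G.Adj (p a) (q b) <;> simp [genLaplacian, hab, h, hf _ _ hab]
    rw [SetLike.mem_coe, RingHom.mem_ker, hdet]
    by_cases hp : (f ∘ p).Injective
    · obtain rfl : i = k := le_antisymm (by simpa using Fintype.card_le_of_injective _ hp) hi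
      have hmul : M.submatrix (f ∘ p) (f ∘ q) =
          (1 : Matrix _ _ R).submatrix (f ∘ p) id * M *
            (1 : Matrix _ _ R).submatrix id (f ∘ q) := by
        ext1 a b
        simp [Matrix.mul_apply, Matrix.one_apply]
      rw [hmul, Matrix.det_mul, Matrix.det_mul, hM, mul_zero, zero_mul]
    · obtain ⟨a, b, hab, hne⟩ := Function.not_injective_iff.1 hp
      exact Matrix.det_zero_of_row_eq hne (by ext1 c; simp only [Matrix.submatrix_apply, hab])
  have h1 : (1 : MvPolynomial V R) ∈ RingHom.ker ev := hle (htop ▸ Submodule.mem_top)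
  simp at h1
end Corank

/-! ### Constant `3 × 3` minors of the forbidden graphs. -/

theorem isUnit_mvPolynomial_of_eq {σ : Type*} {p : MvPolynomial σ ℝ} {c : ℝ} (hc : c ≠ 0)
    (h : p = MvPolynomial.C c) :
    IsUnit p := h ▸ (isUnit_iff_ne_zero.2 hc).map MvPolynomial.C

theorem criticalIdeal_pathGraph_four [DecidableRel (SimpleGraph.pathGraph 4).Adj] :
    criticalIdeal ℝ (SimpleGraph.pathGraph 4) 3 = ⊤ := by
  -- This submatrix is lower triangular with diagonal entries `-1`.
  refine criticalIdeal_eq_top_of_minor ![0, 1, 2] ![1, 2, 3] (by decide) (by decide)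
    (isUnit_mvPolynomial_of_eq (c := -1) (by norm_num) ?_)
  rw [Matrix.det_fin_three]
  simp [genLaplacian, SimpleGraph.pathGraph_adj]

theorem criticalIdeal_ltimesGraph [DecidableRel ltimesGraph.Adj] :
    criticalIdeal ℝ ltimesGraph 3 = ⊤ := by
  -- The variable of vertex `2` occurs in this submatrix, but its cofactor is zero.
  refine criticalIdeal_eq_top_of_minor ![0, 2, 3] ![1, 2, 4] (by decide) (by decide)
    (isUnit_mvPolynomial_of_eq (c := 1) (by norm_num) ?_)
  rw [Matrix.det_fin_three]
  simp [genLaplacian, ltimesGraph]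

theorem criticalIdeal_dartGraph [DecidableRel dartGraph.Adj] :
    criticalIdeal ℝ dartGraph 3 = ⊤ := by
  refine criticalIdeal_eq_top_of_minor ![0, 1, 2] ![1, 3, 4] (by decide) (by decide)
    (isUnit_mvPolynomial_of_eq (c := -1) (by norm_num) ?_)
  rw [Matrix.det_fin_three]
  simp [genLaplacian, dartGraph]

theorem criticalIdeal_kFiveMinusPThree [DecidableRel kFiveMinusPThree.Adj] :
    criticalIdeal ℝ kFiveMinusPThree 3 = ⊤ := by
  refine criticalIdeal_eq_top_of_minor ![0, 1, 3] ![1, 2, 4] (by decide) (by decide)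
    (isUnit_mvPolynomial_of_eq (c := -1) (by norm_num) ?_)
  rw [Matrix.det_fin_three]
  simp [genLaplacian, kFiveMinusPThree]

theorem criticalIdeal_complPTwoUnionCFour [DecidableRel complPTwoUnionCFour.Adj] :
    criticalIdeal ℝ complPTwoUnionCFour 3 = ⊤ := by
  -- Disjoint row and column sets avoid the variables. The value `2` is a unit over `ℝ`, though not
  -- over `ℤ`.
  refine criticalIdeal_eq_top_of_minor ![.inl 0, .inr 0, .inr 1] ![.inl 1, .inr 2, .inr 3]
    (by decide) (by decide) (isUnit_mvPolynomial_of_eq (c := 2) (by norm_num) ?_)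
  rw [Matrix.det_fin_three]
  simp [genLaplacian, complPTwoUnionCFour, SimpleGraph.cycleGraph_adj,
    SimpleGraph.pathGraph_adj, show (-2 : Fin 4) ≠ 1 by decide, show (-3 : Fin 4) = 1 by decide,
    map_ofNat]
  norm_num

theorem genLaplacian_completeMultipartite_of_ne {R : Type*} [CommRing R] {k : ℕ} {n : Fin k → ℕ}
    [DecidableRel (completeMultipartite n).Adj] {s t : Σ i : Fin k, Fin (n i)} (h : s ≠ t) :
    genLaplacian R (completeMultipartite n) s t = if s.1 = t.1 then 0 else -1 := by
  by_cases hst : s.1 = t.1 <;> simp [genLaplacian, completeMultipartite, h, hst]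

/-- A minor of the generalized Laplacian of a complete multipartite graph on disjoint sets of rows
and columns is determined by the parts `P a` of the rows and `Q b` of the columns. -/
theorem criticalIdeal_completeMultipartite_eq_top {k i : ℕ} {n : Fin k → ℕ}
    [DecidableRel (completeMultipartite n).Adj] (p q : Fin i → Σ j : Fin k, Fin (n j))
    (P Q : Fin i → Fin k) (hp : p.Injective) (hq : q.Injective) (hne : ∀ a b, p a ≠ q b)
    (hP : ∀ a, (p a).1 = P a) (hQ : ∀ a, (q a).1 = Q a)
    (hdet : (Matrix.of fun a b => if P a = Q b then (0 : ℝ) else -1).det ≠ 0) :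
    criticalIdeal ℝ (completeMultipartite n) i = ⊤ := by
  refine criticalIdeal_eq_top_of_minor p q hp hq (isUnit_mvPolynomial_of_eq hdet ?_)
  rw [RingHom.map_det]
  congr 1
  ext1 a b
  rw [Matrix.submatrix_apply, genLaplacian_completeMultipartite_of_ne (hne a b), hP, hQ]
  by_cases h : P a = Q b <;> simp [h]

theorem criticalIdeal_completeMultipartite_two_two_two
    [DecidableRel (completeMultipartite ![2, 2, 2]).Adj] :
    criticalIdeal ℝ (completeMultipartite ![2, 2, 2]) 3 = ⊤ := by
  refine criticalIdeal_completeMultipartite_eq_top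
    ![⟨0, 0, by decide⟩, ⟨1, 0, by decide⟩, ⟨2, 0, by decide⟩]
    ![⟨0, 1, by decide⟩, ⟨1, 1, by decide⟩, ⟨2, 1, by decide⟩] ![0, 1, 2] ![0, 1, 2]
    (by decide) (by decide) (by decide) (by decide) (by decide) ?_
  rw [Matrix.det_fin_three]
  simp

theorem criticalIdeal_completeMultipartite_two_two_one_one
    [DecidableRel (completeMultipartite ![2, 2, 1, 1]).Adj] :
    criticalIdeal ℝ (completeMultipartite ![2, 2, 1, 1]) 3 = ⊤ := by
  refine criticalIdeal_completeMultipartite_eq_top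
    ![⟨0, 0, by decide⟩, ⟨1, 0, by decide⟩, ⟨2, 0, by decide⟩]
    ![⟨0, 1, by decide⟩, ⟨1, 1, by decide⟩, ⟨3, 0, by decide⟩] ![0, 1, 2] ![0, 1, 3]
    (by decide) (by decide) (by decide) (by decide) (by decide) ?_
  rw [Matrix.det_fin_three]
  simp

/-! ### Contradictions from explicit copies of the forbidden graphs. -/

section Induced
variable {V : Type*} {G : SimpleGraph V}

theorem IndFree.false_of_map {W : Type*} {H : SimpleGraph W} (h : IndFree H G) (φ : W → V)
    (hne : ∀ x y, x ≠ y → φ x ≠ φ y) (hadj : ∀ x y, G.Adj (φ x) (φ y) ↔ H.Adj x y) : False :=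
  h ⟨⟨φ, fun x y hxy => by_contra fun hn => hne x y hn hxy⟩, hadj _ _⟩

theorem false_of_pathGraph_four (h : IndFree (SimpleGraph.pathGraph 4) G) {a b c d : V}
    (hab : G.Adj a b) (hbc : G.Adj b c) (hcd : G.Adj c d) (hac : ¬ G.Adj a c) (hbd : ¬ G.Adj b d)
    (had : ¬ G.Adj a d) : False := by
  -- Nonadjacent vertices are told apart by a third vertex adjacent to only one of them.
  have : a ≠ c := by rintro rfl; exact had hcd
  have : b ≠ d := by rintro rfl; exact had hab
  have : a ≠ d := by rintro rfl; exact hac hcd.symm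
  refine h.false_of_map ![a, b, c, d] ?_ ?_ <;> intro x y <;> fin_cases x <;> fin_cases y <;>
    simp_all [SimpleGraph.pathGraph_adj, G.adj_comm, hab.ne, hab.ne', hbc.ne, hbc.ne', hcd.ne,
      hcd.ne', ne_comm]

/-- `⋉` is the join of the vertex `d` with the disjoint union of the edge `b c` and the vertices
`v`, `a`. -/
theorem false_of_ltimesGraph (h : IndFree ltimesGraph G) {d b c a v : V}
    (hdb : G.Adj d b) (hdc : G.Adj d c) (hbc : G.Adj b c) (hda : G.Adj d a) (hdv : G.Adj d v)
    (hva : ¬ G.Adj v a) (hne : v ≠ a) (hab : ¬ G.Adj a b) (hac : ¬ G.Adj a c)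
    (hvb : ¬ G.Adj v b) (hvc : ¬ G.Adj v c) : False := by
  have : a ≠ b := by rintro rfl; exact hac hbc
  have : a ≠ c := by rintro rfl; exact hab hbc.symm
  have : v ≠ b := by rintro rfl; exact hvc hbc
  have : v ≠ c := by rintro rfl; exact hvb hbc.symm
  refine h.false_of_map ![b, c, d, a, v] ?_ ?_ <;> intro x y <;> fin_cases x <;> fin_cases y <;>
    simp_all [ltimesGraph, G.adj_comm, hdb.ne, hdb.ne', hdc.ne, hdc.ne', hbc.ne, hbc.ne', hda.ne,
      hda.ne', hdv.ne, hdv.ne', ne_comm]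

/-- The dart is the join of the vertex `d` with the disjoint union of the path `u v w` and the
vertex `a`. -/
theorem false_of_dartGraph (h : IndFree dartGraph G) {d u v w a : V}
    (hdu : G.Adj d u) (hdv : G.Adj d v) (hdw : G.Adj d w) (hda : G.Adj d a) (huv : G.Adj u v)
    (hvw : G.Adj v w) (huw : ¬ G.Adj u w) (hne : u ≠ w) (hau : ¬ G.Adj a u) (hav : ¬ G.Adj a v)
    (haw : ¬ G.Adj a w) : False := by
  have : a ≠ u := by rintro rfl; exact hav huv
  have : a ≠ v := by rintro rfl; exact hau huv.symm
  have : a ≠ w := by rintro rfl; exact hav hvw.symm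
  refine h.false_of_map ![u, v, d, w, a] ?_ ?_ <;> intro x y <;> fin_cases x <;> fin_cases y <;>
    simp_all [dartGraph, G.adj_comm, hdu.ne, hdu.ne', hdv.ne, hdv.ne', hdw.ne, hdw.ne', hda.ne,
      hda.ne', huv.ne, huv.ne', hvw.ne, hvw.ne', ne_comm]

/-- `K₅ ∖ P₃` is the join of the edge `d e` with the disjoint union of the edge `b c` and the
vertex `a`. -/
theorem false_of_kFiveMinusPThree (h : IndFree kFiveMinusPThree G) {d e a b c : V}
    (hde : G.Adj d e) (hda : G.Adj d a) (hdb : G.Adj d b) (hdc : G.Adj d c) (hea : G.Adj e a)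
    (heb : G.Adj e b) (hec : G.Adj e c) (hbc : G.Adj b c) (hab : ¬ G.Adj a b)
    (hac : ¬ G.Adj a c) : False := by
  have : a ≠ b := by rintro rfl; exact hac hbc
  have : a ≠ c := by rintro rfl; exact hab hbc.symm
  refine h.false_of_map ![b, a, c, d, e] ?_ ?_ <;> intro x y <;> fin_cases x <;> fin_cases y <;>
    simp_all [kFiveMinusPThree, G.adj_comm, hde.ne, hde.ne', hda.ne, hda.ne', hdb.ne, hdb.ne',
      hdc.ne, hdc.ne', hea.ne, hea.ne', heb.ne, heb.ne', hec.ne, hec.ne', hbc.ne, hbc.ne', ne_comm]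

/-- The complement of `P₂ ∪ C₄` is the join of two nonadjacent vertices `d`, `e` with the disjoint
union of the edges `a b` and `u v`. -/
theorem false_of_complPTwoUnionCFour (h : IndFree complPTwoUnionCFour G) {d e a b u v : V}
    (hde : ¬ G.Adj d e) (hne : d ≠ e) (hda : G.Adj d a) (hdb : G.Adj d b) (hdu : G.Adj d u)
    (hdv : G.Adj d v) (hea : G.Adj e a) (heb : G.Adj e b) (heu : G.Adj e u) (hev : G.Adj e v)
    (hab : G.Adj a b) (huv : G.Adj u v) (hau : ¬ G.Adj a u) (hav : ¬ G.Adj a v)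
    (hbu : ¬ G.Adj b u) (hbv : ¬ G.Adj b v) : False := by
  have : a ≠ u := by rintro rfl; exact hav huv
  have : a ≠ v := by rintro rfl; exact hau huv.symm
  have : b ≠ u := by rintro rfl; exact hbv huv
  have : b ≠ v := by rintro rfl; exact hbu huv.symm
  -- In the complement of `C₄` the edges join opposite vertices, so `a b` and `u v` are interleaved.
  refine h.false_of_map (Sum.elim ![d, e] ![a, u, b, v]) ?_ ?_ <;> rintro (x | x) (y | y) <;>
    fin_cases x <;> fin_cases y <;>
    simp_all [complPTwoUnionCFour, SimpleGraph.cycleGraph_adj, SimpleGraph.pathGraph_adj,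
      show (-2 : Fin 4) = 2 by decide, show (-3 : Fin 4) = 1 by decide,
      G.adj_comm, hda.ne, hda.ne', hdb.ne, hdb.ne', hdu.ne, hdu.ne', hdv.ne, hdv.ne', hea.ne,
      hea.ne', heb.ne, heb.ne', heu.ne, heu.ne', hev.ne, hev.ne', hab.ne, hab.ne', huv.ne, huv.ne',
      ne_comm]

theorem false_of_completeMultipartite {k : ℕ} {n : Fin k → ℕ}
    (h : IndFree (completeMultipartite n) G) (φ : ∀ i, Fin (n i) → V)
    (hφ : ∀ i, (φ i).Injective) (hsame : ∀ i x y, ¬ G.Adj (φ i x) (φ i y))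
    (hdiff : ∀ i j x y, i < j → G.Adj (φ i x) (φ j y)) : False := by
  have hdiff' : ∀ i j x y, i ≠ j → G.Adj (φ i x) (φ j y) := fun i j x y hij =>
    hij.lt_or_gt.elim (hdiff i j x y) fun hlt => (hdiff j i y x hlt).symm
  refine h.false_of_map (fun s => φ s.1 s.2) ?_ ?_
  · rintro ⟨i, x⟩ ⟨j, y⟩ hne heq
    by_cases hij : i = j
    · subst hij
      exact hne (congrArg (Sigma.mk i) (hφ i heq))
    · exact (hdiff' i j x y hij).ne heq
  · rintro ⟨i, x⟩ ⟨j, y⟩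
    by_cases hij : i = j
    · subst hij
      simpa [completeMultipartite] using hsame i x y
    · simpa [completeMultipartite, hij] using hdiff' i j x y hij

theorem false_of_completeMultipartite_two_two_two
    (h : IndFree (completeMultipartite ![2, 2, 2]) G) {a b c d e f : V}
    (hab : ¬ G.Adj a b) (hab' : a ≠ b) (hcd : ¬ G.Adj c d) (hcd' : c ≠ d)
    (hef : ¬ G.Adj e f) (hef' : e ≠ f) (hac : G.Adj a c) (had : G.Adj a d) (hae : G.Adj a e)
    (haf : G.Adj a f) (hbc : G.Adj b c) (hbd : G.Adj b d) (hbe : G.Adj b e) (hbf : G.Adj b f)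
    (hce : G.Adj c e) (hcf : G.Adj c f) (hde : G.Adj d e) (hdf : G.Adj d f) : False := by
  refine false_of_completeMultipartite h
    (fun i => match i with | 0 => ![a, b] | 1 => ![c, d] | 2 => ![e, f]) ?_ ?_ ?_
  · intro i x y
    fin_cases i <;> fin_cases x <;> fin_cases y <;> simp [hab', hcd', hef', eq_comm]
  · intro i x y
    fin_cases i <;> fin_cases x <;> fin_cases y <;> simp [*, G.adj_comm]
  · intro i j x y hij
    fin_cases i <;> fin_cases j <;> first | exact absurd hij (by decide) | skip
    all_goals fin_cases x <;> fin_cases y <;> assumption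

theorem false_of_completeMultipartite_two_two_one_one
    (h : IndFree (completeMultipartite ![2, 2, 1, 1]) G) {a b c d e f : V}
    (hab : ¬ G.Adj a b) (hab' : a ≠ b) (hcd : ¬ G.Adj c d) (hcd' : c ≠ d)
    (hef : G.Adj e f) (hac : G.Adj a c) (had : G.Adj a d) (hae : G.Adj a e)
    (haf : G.Adj a f) (hbc : G.Adj b c) (hbd : G.Adj b d) (hbe : G.Adj b e) (hbf : G.Adj b f)
    (hce : G.Adj c e) (hcf : G.Adj c f) (hde : G.Adj d e) (hdf : G.Adj d f) : False := by
  refine false_of_completeMultipartite h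
    (fun i => match i with | 0 => ![a, b] | 1 => ![c, d] | 2 => ![e] | 3 => ![f]) ?_ ?_ ?_
  · intro i x y
    fin_cases i <;> fin_cases x <;> fin_cases y <;> simp [hab', hcd', eq_comm]
  · intro i x y
    fin_cases i <;> fin_cases x <;> fin_cases y <;> simp [*, G.adj_comm]
  · intro i j x y hij
    fin_cases i <;> fin_cases j <;> first | exact absurd hij (by decide) | skip
    all_goals fin_cases x <;> fin_cases y <;> assumption

end Induced

/-! ### Structure of graphs without the forbidden subgraphs. -/

section Structure
variable {V : Type*} {G : SimpleGraph V}

/-- A connected `P₄`-free graph has diameter at most two: along a walk, the first vertex at distance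
three would complete an induced `P₄`. -/
theorem exists_common_neighbor (hP : IndFree (SimpleGraph.pathGraph 4) G) (hG : G.Connected)
    {u w : V} (hne : u ≠ w) (huw : ¬ G.Adj u w) : ∃ x, G.Adj u x ∧ G.Adj x w := by
  suffices h : w = u ∨ G.Adj u w ∨ ∃ x, G.Adj u x ∧ G.Adj x w from
    (h.resolve_left hne.symm).resolve_left huw
  obtain ⟨p⟩ := hG.preconnected u w
  clear hne huw
  induction p using SimpleGraph.Walk.concatRec with
  | Hnil => exact Or.inl rfl
  | @Hconcat u w y p hwy ih =>
    by_contra! hcon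
    obtain ⟨hyu, huy, hno⟩ := hcon
    rcases ih with rfl | huw | ⟨x, hux, hxw⟩
    · exact huy hwy
    · exact hno _ huw hwy
    · exact false_of_pathGraph_four hP hux hxw hwy (fun h => hno _ h hwy) (hno x hux) huy

/-- The vertex classes of a join of an independent set `D` with two disjoint cliques `A` and `B`. -/
structure IsCoCompleteJoin (G : SimpleGraph V) (f : V → Fin 3) : Prop where
  not_adj_zero : ∀ u v, f u = 0 → f v = 0 → ¬ G.Adj u v
  adj_one : ∀ u v, u ≠ v → f u = 1 → f v = 1 → G.Adj u v
  adj_two : ∀ u v, u ≠ v → f u = 2 → f v = 2 → G.Adj u v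
  not_adj_one_two : ∀ u v, f u = 1 → f v = 2 → ¬ G.Adj u v
  adj_zero : ∀ u v, f u = 0 → f v ≠ 0 → G.Adj u v

/-- If a connected graph without five of the forbidden induced subgraphs has an edge `b c` and a
vertex `a` adjacent to neither end, then it is a join of an independent set with two disjoint cliques. -/
theorem exists_isCoCompleteJoin_of_not_transitive
    (hP : IndFree (SimpleGraph.pathGraph 4) G) (hL : IndFree ltimesGraph G)
    (hD : IndFree dartGraph G) (hK : IndFree kFiveMinusPThree G)
    (hC : IndFree complPTwoUnionCFour G) (hG : G.Connected) {a b c : V} (hab : ¬ G.Adj a b)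
    (hac : ¬ G.Adj a c) (hbc : G.Adj b c) :
    ∃ f, IsCoCompleteJoin G f ∧ ((∀ u v, f u = 0 → f v = 0 → u = v) ∨
      (∀ u v, f u = 1 → f v = 1 → u = v)) := by
  classical
  have hab' : a ≠ b := by rintro rfl; exact hac hbc
  have hac' : a ≠ c := by rintro rfl; exact hab hbc.symm
  have hD1 : ∀ d, G.Adj a d → G.Adj d b → G.Adj d c := fun d had hdb => by
    by_contra hdc
    exact false_of_pathGraph_four hP had hdb hbc hab hdc hac
  have hD2 : ∀ d, G.Adj a d → G.Adj d c → G.Adj d b := fun d had hdc => by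
    by_contra hdb
    exact false_of_pathGraph_four hP had hdc hbc.symm hac hdb hab
  obtain ⟨d, had, hdb⟩ := exists_common_neighbor hP hG hab' hab
  have hdc := hD1 d had hdb
  -- a vertex adjacent to `a` only, among `a`, `b`, `c`, is adjacent to all common neighbors
  have hA : ∀ v e, G.Adj a v → ¬ G.Adj v b → G.Adj a e → G.Adj e b → G.Adj e v :=
    fun v e hav hvb hae heb => by
      by_contra hev
      exact false_of_pathGraph_four hP hav.symm hae heb (fun h => hev h.symm) hab hvb
  have hB : ∀ v e, ¬ G.Adj a v → G.Adj v b → G.Adj a e → G.Adj e b → G.Adj e v :=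
    fun v e hav hvb hae heb => by
      by_contra hev
      exact false_of_pathGraph_four hP hvb heb.symm hae.symm (fun h => hev h.symm)
        (fun h => hab h.symm) fun h => hav h.symm
  have hB' : ∀ v e, ¬ G.Adj a v → G.Adj v c → G.Adj a e → G.Adj e c → G.Adj e v :=
    fun v e hav hvc hae hec => by
      by_contra hev
      exact false_of_pathGraph_four hP hvc hec.symm hae.symm (fun h => hev h.symm)
        (fun h => hac h.symm) fun h => hav h.symm
  -- Otherwise `d`, joined to the path `b c v` and to `a`, gives a dart.
  have hBb : ∀ v, v ≠ b → ¬ G.Adj a v → G.Adj v c → G.Adj v b := fun v hvb' hav hvc => by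
    by_contra hvb
    exact false_of_dartGraph hD hdb hdc (hB' v d hav hvc had hdc) had.symm hbc hvc.symm
      (fun h => hvb h.symm) hvb'.symm hab hac hav
  have hBc : ∀ v, v ≠ c → ¬ G.Adj a v → G.Adj v b → G.Adj v c := fun v hvc' hav hvb => by
    by_contra hvc
    exact false_of_dartGraph hD hdc hdb (hB v d hav hvb had hdb) had.symm hbc.symm hvb.symm
      (fun h => hvc h.symm) hvc'.symm hac hab hav
  -- Excluding `⋉` keeps `v` away from all common neighbors of `a` and `b`; a common neighbor `w` of
  -- `a` and `v` then yields the induced path `v w d b`.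
  have hnone : ∀ v, v ≠ a → ¬ G.Adj a v → ¬ G.Adj v b → ¬ G.Adj v c → False :=
    fun v hva hav hvb hvc => by
      have hdv : ∀ e, G.Adj a e → G.Adj e b → ¬ G.Adj e v := fun e hae heb hev =>
        false_of_ltimesGraph hL heb (hD1 e hae heb) hbc hae.symm hev (fun h => hav h.symm) hva
          hab hac hvb hvc
      obtain ⟨w, haw, hwv⟩ := exists_common_neighbor hP hG hva.symm hav
      have hwb : ¬ G.Adj w b := fun h => hdv w haw h hwv
      exact false_of_pathGraph_four hP hwv.symm (hA w d haw hwb had hdb).symm hdb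
        (fun h => hdv d had hdb h.symm) hwb hvb
  -- Class `0` is the common neighbors of `a` and `b`, class `2` the side of `b`, and class `1` the
  -- rest, which `hnone` will confine to `a` and its neighbors.
  let f : V → Fin 3 := fun v => if v = b ∨ ¬ G.Adj a v ∧ G.Adj v b then 2 else
    if G.Adj a v ∧ G.Adj v b then 0 else 1
  have f0 : ∀ v, f v = 0 → G.Adj a v ∧ G.Adj v b := fun v hv => by
    simp only [f] at hv; split_ifs at hv <;> simp_all
  have f2 : ∀ v, f v = 2 → v = b ∨ ¬ G.Adj a v ∧ G.Adj v b := fun v hv => by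
    simp only [f] at hv; split_ifs at hv <;> simp_all
  have f1 : ∀ v, f v = 1 → v = a ∨ G.Adj a v ∧ ¬ G.Adj v b := fun v hv => by
    have hv' : ¬ (v = b ∨ ¬ G.Adj a v ∧ G.Adj v b) ∧ ¬ (G.Adj a v ∧ G.Adj v b) := by
      simp only [f] at hv; split_ifs at hv <;> simp_all
    by_contra hcon
    have hva : ¬ G.Adj a v := by tauto
    have hvb : ¬ G.Adj v b := by tauto
    exact hnone v (by tauto) hva hvb fun h => hvb (hBb v (by tauto) hva h)
  have f1b : ∀ v, f v = 1 → ¬ G.Adj v b := fun v hv => by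
    rcases f1 v hv with rfl | h
    exacts [hab, h.2]
  have f2a : ∀ v, f v = 2 → ¬ G.Adj a v := fun v hv => by
    rcases f2 v hv with rfl | h
    exacts [hab, h.1]
  have hdisj : ∀ u v, f u = 1 → f v = 2 → ¬ G.Adj u v := fun u v hu hv huv => by
    rcases f1 u hu with rfl | ⟨hau, hub⟩
    · exact f2a v hv huv
    · rcases f2 v hv with rfl | ⟨hav, hvb⟩
      · exact hub huv
      · exact false_of_pathGraph_four hP hau huv hvb hav hub hab
  have hzero_one : ∀ u v, f u = 0 → f v = 1 → G.Adj u v := fun u v hu hv => by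
    rcases f1 v hv with rfl | ⟨hav, hvb⟩
    · exact (f0 u hu).1.symm
    · exact hA v u hav hvb (f0 u hu).1 (f0 u hu).2
  have hzero_two : ∀ u v, f u = 0 → f v = 2 → G.Adj u v := fun u v hu hv => by
    rcases f2 v hv with rfl | ⟨hav, hvb⟩
    · exact (f0 u hu).2
    · exact hB v u hav hvb (f0 u hu).1 (f0 u hu).2
  have hfd : f d = 0 := by simp [f, had, hdb, hdb.ne]
  have hone : ∀ u v, u ≠ v → f u = 1 → f v = 1 → G.Adj u v := fun u v huv hu hv => by
    rcases f1 u hu with rfl | ⟨hau, hub⟩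
    · exact ((f1 v hv).resolve_left huv.symm).1
    · rcases f1 v hv with rfl | ⟨hav, hvb⟩
      · exact hau.symm
      · by_contra hn
        exact false_of_dartGraph hD (hzero_one d u hfd hu) had.symm (hzero_one d v hfd hv) hdb
          hau.symm hav hn huv (fun h => hub h.symm) (fun h => hab h.symm) fun h => hvb h.symm
  have htwo : ∀ u v, u ≠ v → f u = 2 → f v = 2 → G.Adj u v := fun u v huv hu hv => by
    rcases f2 u hu with rfl | ⟨hau, hub⟩
    · exact ((f2 v hv).resolve_left huv.symm).2.symm
    · rcases f2 v hv with rfl | ⟨hav, hvb⟩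
      · exact hub
      · by_contra hn
        exact false_of_dartGraph hD (hzero_two d u hfd hu) hdb (hzero_two d v hfd hv) had.symm
          hub hvb.symm hn huv hau hab hav
  have hz : ∀ u v, f u = 0 → f v = 0 → ¬ G.Adj u v := fun u v hu hv huv => by
    obtain ⟨hau, hub⟩ := f0 u hu
    obtain ⟨hav, hvb⟩ := f0 v hv
    exact false_of_kFiveMinusPThree hK huv hau.symm hub (hD1 u hau hub) hav.symm hvb
      (hD1 v hav hvb) hbc hab hac
  refine ⟨f, ⟨hz, hone, htwo, hdisj, fun u v hu hv => ?_⟩, ?_⟩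
  · obtain h | h : f v = 1 ∨ f v = 2 := by omega
    exacts [hzero_one u v hu h, hzero_two u v hu h]
  -- Class `2` contains the edge `b c`, so two vertices in each of classes `0` and `1` would
  -- complete the complement of `P₂ ∪ C₄`.
  · by_contra! hcon
    obtain ⟨⟨u, v, hu, hv, huv⟩, x, y, hx, hy, hxy⟩ := hcon
    obtain ⟨hau, hub⟩ := f0 u hu
    obtain ⟨hav, hvb⟩ := f0 v hv
    have hfb : f b = 2 := by simp [f]
    have hfc : f c = 2 := by simp [f, hac, hbc.symm]
    exact false_of_complPTwoUnionCFour hC (hz u v hu hv) huv (hzero_one u x hu hx)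
      (hzero_one u y hu hy) hub (hD1 u hau hub) (hzero_one v x hv hx) (hzero_one v y hv hy) hvb
      (hD1 v hav hvb) (hone x y hxy hx hy) hbc (hdisj x b hx hfb) (hdisj x c hx hfc)
      (hdisj y b hy hfb) (hdisj y c hy hfc)

/-- A graph in which nonadjacency is transitive and which contains neither `K_{2,2,2}` nor
`K_{2,2,1,1}` is complete tripartite with one part of size at most one, or the join of an
independent set and a clique. -/
theorem exists_classes_of_transitive
    (h222 : IndFree (completeMultipartite ![2, 2, 2]) G)
    (h2211 : IndFree (completeMultipartite ![2, 2, 1, 1]) G)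
    (htrans : ∀ a b c, ¬ G.Adj a b → ¬ G.Adj a c → ¬ G.Adj b c) :
    ∃ f : V → Fin 3, ((∀ u v, G.Adj u v ↔ f u ≠ f v) ∧ ∀ u v, f u = 0 → f v = 0 → u = v) ∨
      IsCoCompleteJoin G f ∧ ∀ u v, f u = 1 → f v = 1 → u = v := by
  classical
  by_cases hpart : ∃ a b c d, a ≠ b ∧ ¬ G.Adj a b ∧ c ≠ d ∧ ¬ G.Adj c d ∧ G.Adj a c
  · obtain ⟨a, b, c, d, hab, hab', hcd, hcd', hac⟩ := hpart
    have hadj : ∀ {u v w}, ¬ G.Adj u v → G.Adj u w → G.Adj v w := fun huv huw => by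
      by_contra hvw
      exact htrans _ _ _ (fun h => huv h.symm) hvw huw
    have hbc := hadj hab' hac
    have had := (hadj hcd' hac.symm).symm
    have hbd := hadj hab' had
    -- Classes `1` and `2` are the parts of `a` and `c`, each with at least two vertices; two
    -- further vertices would give `K_{2,2,1,1}` or `K_{2,2,2}`.
    let f : V → Fin 3 := fun v => if ¬ G.Adj a v then 1 else if ¬ G.Adj c v then 2 else 0
    have f0 : ∀ v, f v = 0 → G.Adj a v ∧ G.Adj c v := fun v hv => by
      simp only [f] at hv; split_ifs at hv <;> simp_all
    have f1 : ∀ v, f v = 1 → ¬ G.Adj a v := fun v hv => by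
      simp only [f] at hv; split_ifs at hv <;> simp_all
    have f2 : ∀ v, f v = 2 → G.Adj a v ∧ ¬ G.Adj c v := fun v hv => by
      simp only [f] at hv; split_ifs at hv <;> simp_all
    have hsub : ∀ u v, f u = 0 → f v = 0 → u = v := fun u v hu hv => by
      by_contra huv
      obtain ⟨hau, hcu⟩ := f0 u hu
      obtain ⟨hav, hcv⟩ := f0 v hv
      by_cases h : G.Adj u v
      · exact false_of_completeMultipartite_two_two_one_one h2211 hab' hab hcd' hcd h hac had hau
          hav hbc hbd (hadj hab' hau) (hadj hab' hav) hcu hcv (hadj hcd' hcu) (hadj hcd' hcv)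
      · exact false_of_completeMultipartite_two_two_two h222 hab' hab hcd' hcd h huv hac had hau
          hav hbc hbd (hadj hab' hau) (hadj hab' hav) hcu hcv (hadj hcd' hcu) (hadj hcd' hcv)
    have hcongr : ∀ u v, ¬ G.Adj u v → f u = f v := fun u v huv => by
      have h1 : G.Adj a u ↔ G.Adj a v :=
        ⟨fun h => (hadj huv h.symm).symm, fun h => (hadj (fun h => huv h.symm) h.symm).symm⟩
      have h2 : G.Adj c u ↔ G.Adj c v :=
        ⟨fun h => (hadj huv h.symm).symm, fun h => (hadj (fun h => huv h.symm) h.symm).symm⟩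
      simp only [f, h1, h2]
    refine ⟨f, Or.inl ⟨fun u v => ⟨fun huv heq => ?_, fun h => ?_⟩, hsub⟩⟩
    · obtain h | h | h : f u = 0 ∨ f u = 1 ∨ f u = 2 := by omega
      · exact huv.ne (hsub u v h (heq ▸ h))
      · exact htrans a u v (f1 u h) (f1 v (heq ▸ h)) huv
      · exact htrans c u v (f2 u h).2 (f2 v (heq ▸ h)).2 huv
    · by_contra hn
      exact h (hcongr u v hn)
  · push Not at hpart
    -- At most one part is nontrivial: it is class `0`, the dominating vertices are class `2`, and
    -- class `1` is empty.
    refine ⟨fun v => if ∃ w, v ≠ w ∧ ¬ G.Adj v w then 0 else 2, Or.inr ⟨⟨?_, ?_, ?_, ?_, ?_⟩, ?_⟩⟩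
    · intro u v hu hv
      simp only [ite_eq_left_iff] at hu hv
      obtain ⟨x, hx, hx'⟩ : ∃ w, u ≠ w ∧ ¬ G.Adj u w := by
        by_contra h; exact absurd (hu h) (by decide)
      obtain ⟨y, hy, hy'⟩ : ∃ w, v ≠ w ∧ ¬ G.Adj v w := by
        by_contra h; exact absurd (hv h) (by decide)
      exact hpart u x v y hx hx' hy hy'
    · intro u v _ hu; split_ifs at hu <;> simp at hu
    · intro u v huv hu
      by_contra! h
      rw [if_pos ⟨v, huv, h.2⟩] at hu
      simp at hu
    · intro u v hu; split_ifs at hu <;> simp at hu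
    · intro u v hu hv
      by_contra h
      have huv : u ≠ v := by rintro rfl; exact hv hu
      exact hv (if_pos ⟨u, huv.symm, fun h' => h h'.symm⟩)
    · intro u v hu; dsimp only at hu; split_ifs at hu <;> simp at hu

end Structure

/-! ### From vertex classes to induced embeddings and co-rank bounds. -/

section Classes
variable {V W : Type*} {G : SimpleGraph V} {H : SimpleGraph W}

theorem IsCoCompleteJoin.comap {f : W → Fin 3} (hf : IsCoCompleteJoin H f) (φ : G ↪g H) :
    IsCoCompleteJoin G (f ∘ φ) where
  not_adj_zero _ _ hu hv h := hf.not_adj_zero _ _ hu hv (φ.map_adj_iff.2 h)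
  adj_one _ _ huv hu hv := φ.map_adj_iff.1 (hf.adj_one _ _ (φ.injective.ne huv) hu hv)
  adj_two _ _ huv hu hv := φ.map_adj_iff.1 (hf.adj_two _ _ (φ.injective.ne huv) hu hv)
  not_adj_one_two _ _ hu hv h := hf.not_adj_one_two _ _ hu hv (φ.map_adj_iff.2 h)
  adj_zero _ _ hu hv := φ.map_adj_iff.1 (hf.adj_zero _ _ hu hv)

/-- The classes determine adjacency, so every class-preserving injection between such graphs is an
induced embedding. -/
theorem IsCoCompleteJoin.adj_iff {f : V → Fin 3} (hf : IsCoCompleteJoin G f) {u v : V}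
    (huv : u ≠ v) : G.Adj u v ↔ f u = f v ∧ f u ≠ 0 ∨ f u ≠ f v ∧ (f u = 0 ∨ f v = 0) := by
  have h (w : V) : f w = 0 ∨ f w = 1 ∨ f w = 2 := by omega
  rcases h u with hu | hu | hu <;> rcases h v with hv | hv | hv <;> simp only [hu, hv]
  · simpa using hf.not_adj_zero u v hu hv
  · simpa using hf.adj_zero u v hu (by simp [hv])
  · simpa using hf.adj_zero u v hu (by simp [hv])
  · simpa using (hf.adj_zero v u hv (by simp [hu])).symm
  · simpa using hf.adj_one u v huv hu hv
  · simpa using hf.not_adj_one_two u v hu hv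
  · simpa using (hf.adj_zero v u hv (by simp [hu])).symm
  · simpa using fun h => hf.not_adj_one_two v u hv hu h.symm
  · simpa using hf.adj_two u v huv hu hv

/-- The three classes of vertices of `K̄_a ∨ (K_b + K_c)`. -/
def coCompleteJoinClass {a b c : ℕ} : Fin a ⊕ (Fin b ⊕ Fin c) → Fin 3 :=
  Sum.elim (fun _ => 0) (Sum.elim (fun _ => 1) fun _ => 2)

theorem isCoCompleteJoin_coCompleteJoin (a b c : ℕ) :
    IsCoCompleteJoin (coCompleteJoin a b c) coCompleteJoinClass := by
  constructor <;> rintro (u | u | u) (v | v | v) <;>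
    simp [coCompleteJoin, coCompleteJoinClass, join]

theorem coCompleteJoinClass_zero_subsingleton {b c : ℕ} (s t : Fin 1 ⊕ (Fin b ⊕ Fin c))
    (hs : coCompleteJoinClass s = 0) (ht : coCompleteJoinClass t = 0) : s = t := by
  rcases s with s | s | s <;> rcases t with t | t | t <;>
    simp [coCompleteJoinClass] at hs ht ⊢
  exact Subsingleton.elim s t

theorem coCompleteJoinClass_one_subsingleton {a c : ℕ} (s t : Fin a ⊕ (Fin 1 ⊕ Fin c))
    (hs : coCompleteJoinClass s = 1) (ht : coCompleteJoinClass t = 1) : s = t := by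
  rcases s with s | s | s <;> rcases t with t | t | t <;>
    simp [coCompleteJoinClass] at hs ht ⊢
  exact Subsingleton.elim s t

theorem IsCoCompleteJoin.isIndContained {f : V → Fin 3} (hf : IsCoCompleteJoin G f) {a b c : ℕ}
    (α : V → Fin a) (β : V → Fin b) (γ : V → Fin c)
    (hα : ∀ u v, f u = 0 → f v = 0 → α u = α v → u = v)
    (hβ : ∀ u v, f u = 1 → f v = 1 → β u = β v → u = v)
    (hγ : ∀ u v, f u = 2 → f v = 2 → γ u = γ v → u = v) :
    G.IsIndContained (coCompleteJoin a b c) := by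
  let φ : V → Fin a ⊕ (Fin b ⊕ Fin c) := fun u =>
    if f u = 0 then .inl (α u) else if f u = 1 then .inr (.inl (β u)) else .inr (.inr (γ u))
  have hφ : ∀ u, coCompleteJoinClass (φ u) = f u := fun u => by
    simp only [φ]
    split_ifs <;> simp [coCompleteJoinClass] <;> omega
  have hinj : φ.Injective := fun u v huv => by
    have hfuv : f u = f v := by rw [← hφ u, ← hφ v, huv]
    obtain h | h | h : f v = 0 ∨ f v = 1 ∨ f v = 2 := by omega
    · exact hα u v (hfuv.trans h) h (by simpa [φ, hfuv, h] using huv)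
    · exact hβ u v (hfuv.trans h) h (by simpa [φ, hfuv, h] using huv)
    · exact hγ u v (hfuv.trans h) h (by simpa [φ, hfuv, h] using huv)
  refine ⟨⟨⟨φ, hinj⟩, fun {u v} => ?_⟩⟩
  by_cases huv : u = v
  · simp [huv]
  · rw [hf.adj_iff huv, ← hφ u, ← hφ v]
    exact (isCoCompleteJoin_coCompleteJoin a b c).adj_iff (hinj.ne huv)

theorem isIndContained_completeMultipartite {k : ℕ} {n : Fin k → ℕ} {f : V → Fin k}
    (hf : ∀ u v, G.Adj u v ↔ f u ≠ f v) (g : ∀ i, V → Fin (n i))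
    (hg : ∀ i u v, f u = i → f v = i → g i u = g i v → u = v) :
    G.IsIndContained (completeMultipartite n) := by
  refine ⟨⟨⟨fun u => ⟨f u, g (f u) u⟩, fun u v huv => ?_⟩, fun {u v} => ?_⟩⟩
  · obtain ⟨h1, h2⟩ := Sigma.mk.inj_iff.1 huv
    refine hg (f u) u v rfl h1.symm (eq_of_heq (h2.trans ?_))
    rw [h1]
  · rw [hf]
    rfl

variable [Fintype V] [DecidableEq V] [DecidableRel G.Adj]

theorem algebraicCorank_le_of_blowup {R : Type*} [CommRing R] [Nontrivial R] {k : ℕ}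
    (M : Matrix (Fin (k + 1)) (Fin (k + 1)) R) (hM : M.det = 0) (f : V → Fin (k + 1))
    (hf : ∀ u v, u ≠ v → M (f u) (f v) = if G.Adj u v then -1 else 0) :
    algebraicCorank R G ≤ k :=
  csSup_le' fun i hi => by
    by_contra! h
    exact criticalIdeal_ne_top_of_blowup M hM f hf i h hi.2

theorem IsCoCompleteJoin.algebraicCorank_le {f : V → Fin 3} (hf : IsCoCompleteJoin G f)
    (h : (∀ u v, f u = 0 → f v = 0 → u = v) ∨ ∀ u v, f u = 1 → f v = 1 → u = v) :
    algebraicCorank ℝ G ≤ 2 := by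
  have h3 (w : V) : f w = 0 ∨ f w = 1 ∨ f w = 2 := by omega
  rcases h with h | h
  -- An independent class of size at least two forces the diagonal entry `0`, and such a clique
  -- forces `-1`. The entry of a class with at most one vertex is free and is chosen to make the
  -- determinant zero: here `-2`, and `1` in the other case.
  · refine algebraicCorank_le_of_blowup !![-2, -1, -1; -1, -1, 0; -1, 0, -1]
      (by rw [Matrix.det_fin_three]; simp; try norm_num) f fun u v huv => ?_
    have := h u v
    rcases h3 u with hu | hu | hu <;> rcases h3 v with hv | hv | hv <;>
      simp_all [hf.adj_iff huv]
  · refine algebraicCorank_le_of_blowup !![0, -1, -1; -1, 1, 0; -1, 0, -1]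
      (by rw [Matrix.det_fin_three]; simp; try norm_num) f fun u v huv => ?_
    have := h u v
    rcases h3 u with hu | hu | hu <;> rcases h3 v with hv | hv | hv <;>
      simp_all [hf.adj_iff huv]

theorem algebraicCorank_le_of_completeTripartite {f : V → Fin 3}
    (hf : ∀ u v, G.Adj u v ↔ f u ≠ f v) (h : ∀ u v, f u = 0 → f v = 0 → u = v) :
    algebraicCorank ℝ G ≤ 2 := by
  have h3 (w : V) : f w = 0 ∨ f w = 1 ∨ f w = 2 := by omega
  -- The free entry `-2` of the small part makes the determinant zero.
  refine algebraicCorank_le_of_blowup !![-2, -1, -1; -1, 0, -1; -1, -1, 0]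
    (by rw [Matrix.det_fin_three]; simp; try norm_num) f fun u v huv => ?_
  have := h u v
  rcases h3 u with hu | hu | hu <;> rcases h3 v with hv | hv | hv <;> simp_all

end Classes
end CriticalIdeal

open CriticalIdeal in
theorem mainTheorem1 {V : Type*} [Fintype V] [DecidableEq V] (G : SimpleGraph V)
    [DecidableRel G.Adj] (hG : G.Connected) :
    List.TFAE [
      CriticalIdeal.algebraicCorank ℝ G ≤ 2,
      CriticalIdeal.IndFree (SimpleGraph.pathGraph 4) G ∧
        CriticalIdeal.IndFree CriticalIdeal.ltimesGraph G ∧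
        CriticalIdeal.IndFree CriticalIdeal.dartGraph G ∧
        CriticalIdeal.IndFree CriticalIdeal.kFiveMinusPThree G ∧
        CriticalIdeal.IndFree CriticalIdeal.complPTwoUnionCFour G ∧
        CriticalIdeal.IndFree (CriticalIdeal.completeMultipartite ![2, 2, 2]) G ∧
        CriticalIdeal.IndFree (CriticalIdeal.completeMultipartite ![2, 2, 1, 1]) G,
      (∃ n₁ n₂ : ℕ, 0 < n₁ ∧ 0 < n₂ ∧
          G.IsIndContained (CriticalIdeal.completeMultipartite ![1, n₁, n₂])) ∨
        (∃ n₂ n₃ : ℕ, 0 < n₂ ∧ 0 < n₃ ∧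
          G.IsIndContained (CriticalIdeal.coCompleteJoin 1 n₂ n₃)) ∨
        (∃ n₁ n₃ : ℕ, 0 < n₁ ∧ 0 < n₃ ∧
          G.IsIndContained (CriticalIdeal.coCompleteJoin n₁ 1 n₃))] := by
  classical
  tfae_have 1 → 2 := fun h =>
    ⟨indFree_of_algebraicCorank_le h (by decide) criticalIdeal_pathGraph_four,
      indFree_of_algebraicCorank_le h (by decide) criticalIdeal_ltimesGraph,
      indFree_of_algebraicCorank_le h (by decide) criticalIdeal_dartGraph,
      indFree_of_algebraicCorank_le h (by decide) criticalIdeal_kFiveMinusPThree,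
      indFree_of_algebraicCorank_le h (by decide) criticalIdeal_complPTwoUnionCFour,
      indFree_of_algebraicCorank_le h (by decide) criticalIdeal_completeMultipartite_two_two_two,
      indFree_of_algebraicCorank_le h (by decide)
        criticalIdeal_completeMultipartite_two_two_one_one⟩
  tfae_have 2 → 3 := by
    rintro ⟨hP, hL, hD, hK, hC, h222, h2211⟩
    have hpos : 0 < Fintype.card V := Fintype.card_pos_iff.2 hG.nonempty
    -- Only an induced embedding is needed, so every unrestricted part may be given size
    -- `Fintype.card V`, with `e` injective on each class.
    let e := Fintype.equivFin V
    have hzero {f : V → Fin 3} (hf : IsCoCompleteJoin G f)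
        (h : ∀ u v, f u = 0 → f v = 0 → u = v) :
        G.IsIndContained (coCompleteJoin 1 (Fintype.card V) (Fintype.card V)) :=
      hf.isIndContained (fun _ => 0) e e (fun u v hu hv _ => h u v hu hv)
        (fun _ _ _ _ h => e.injective h) fun _ _ _ _ h => e.injective h
    have hone {f : V → Fin 3} (hf : IsCoCompleteJoin G f)
        (h : ∀ u v, f u = 1 → f v = 1 → u = v) :
        G.IsIndContained (coCompleteJoin (Fintype.card V) 1 (Fintype.card V)) :=
      hf.isIndContained e (fun _ => 0) e (fun _ _ _ _ h => e.injective h)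
        (fun u v hu hv _ => h u v hu hv) fun _ _ _ _ h => e.injective h
    by_cases htrans : ∀ a b c, ¬ G.Adj a b → ¬ G.Adj a c → ¬ G.Adj b c
    · obtain ⟨f, ⟨hf, h⟩ | ⟨hf, h⟩⟩ := exists_classes_of_transitive h222 h2211 htrans
      · refine Or.inl ⟨_, _, hpos, hpos, isIndContained_completeMultipartite hf
          (fun i => match i with | 0 => fun _ => (0 : Fin 1) | 1 => e | 2 => e) ?_⟩
        intro i u v hu hv huv
        fin_cases i
        exacts [h u v hu hv, e.injective huv, e.injective huv]
      · exact Or.inr (Or.inr ⟨_, _, hpos, hpos, hone hf h⟩)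
    · push Not at htrans
      obtain ⟨a, b, c, hab, hac, hbc⟩ := htrans
      obtain ⟨f, hf, h | h⟩ :=
        exists_isCoCompleteJoin_of_not_transitive hP hL hD hK hC hG hab hac hbc
      · exact Or.inr (Or.inl ⟨_, _, hpos, hpos, hzero hf h⟩)
      · exact Or.inr (Or.inr ⟨_, _, hpos, hpos, hone hf h⟩)
  tfae_have 3 → 1 := by
    rintro (⟨m, n, -, -, ⟨φ⟩⟩ | ⟨m, n, -, -, ⟨φ⟩⟩ | ⟨m, n, -, -, ⟨φ⟩⟩)
    · refine algebraicCorank_le_of_completeTripartite (f := fun u => (φ u).1)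
        (fun u v => by rw [← φ.map_adj_iff]; simp [completeMultipartite]) fun u v hu hv => ?_
      have : ∀ s t : (Σ i : Fin 3, Fin (![1, m, n] i)), s.1 = 0 → t.1 = 0 → s = t := by
        rintro ⟨i, s⟩ ⟨j, t⟩ hi hj
        dsimp only at hi hj
        subst hi hj
        exact congrArg (Sigma.mk 0) (Subsingleton.elim (α := Fin 1) s t)
      exact φ.injective (this _ _ hu hv)
    · refine ((isCoCompleteJoin_coCompleteJoin 1 m n).comap φ).algebraicCorank_le
        (Or.inl fun u v hu hv => φ.injective ?_)
      exact coCompleteJoinClass_zero_subsingleton _ _ hu hv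
    · refine ((isCoCompleteJoin_coCompleteJoin m 1 n).comap φ).algebraicCorank_le
        (Or.inr fun u v hu hv => φ.injective ?_)
      exact coCompleteJoinClass_one_subsingleton _ _ hu hv
  tfae_finish
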